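/- Let $M$ be an elementary extension of the ring of integers $(\mathbb{Z},+,\cdot)$ which is $\kappa$-saturated and $\kappa$-strongly homogeneous for some cardinal $\kappa>2^{\aleph_0}$, and let $G^*=(M,+)$ be its additive group. For a set $A\subseteq M$ with $|A|<\kappa$, let $G_A^{*0}$ be the intersection of all $A$-definable subgroups of $G^*$ of finite index. Let $G_\emptyset^{*00}$ be the smallest among the subgroups of $G^*$ that are type-definable over $\emptyset$ (i.e. intersections of $\emptyset$-definable sets) and of bounded index (i.e. of index less than $\kappa$). Then $G_A^{*0}=\bigcap_{n\ge 1} nM$ for every $A\subseteq M$ with $|A|<\kappa$ (so $G^{*0}$ exists and equals $\bigcap_{n\ge1}nM$), the subgroup $G_\emptyset^{*00}$ exists, and it is strictly smaller than $G^{*0}$: $$G_\emptyset^{*00}\subsetneq G^{*0}=\bigcap_{n\ge 1} nM .$$ Moreover, the set $$X_{\sqrt2}(1/3)=\{n\in\mathbb{Z} : \exists m\in\mathbb{Z},\ |m-n\sqrt2|<1/3\}$$ is definable without parameters in $(\mathbb{Z},+,\cdot)$. -/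

import Mathlib

open scoped FirstOrder Cardinal

namespace ConnectedComponents

open FirstOrder FirstOrder.Language

universe u v w

section Saturation

variable (L : FirstOrder.Language.{u, v}) (M : Type w) [L.Structure M]

/-- `M` is `κ`-saturated: every partial 1-type over a parameter set of cardinality less than `κ`
which is finitely satisfiable in `M` is realized in `M`. -/
def IsSaturated (κ : Cardinal.{w}) : Prop :=
  ∀ A : Set M, #A < κ → ∀ p : Set (L[[A]].Formula (Fin 1)),
    (∀ q : Finset (L[[A]].Formula (Fin 1)), (q : Set (L[[A]].Formula (Fin 1))) ⊆ p →
      ∃ a : M, ∀ φ ∈ q, φ.Realize (fun _ => a)) →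
    ∃ a : M, ∀ φ ∈ p, φ.Realize (fun _ => a)

/-- `M` is `κ`-strongly homogeneous: every partial elementary map `f : A → M` whose domain `A` has
cardinality less than `κ` extends to an automorphism of `M`. -/
def IsStronglyHomogeneous (κ : Cardinal.{w}) : Prop :=
  ∀ A : Set M, #A < κ → ∀ f : A → M,
    (∀ φ : L.Formula A, φ.Realize (fun a : A => (a : M)) ↔ φ.Realize f) →
    ∃ σ : M ≃[L] M, ∀ a : A, σ a = f a

end Saturation

section Components

variable (L : FirstOrder.Language.{u, v}) {M : Type w} [L.Structure M]

/-- A subset of `M` is type-definable over `A` if it is an intersection of `A`-definable subsets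
of `M`. -/
def TypeDefinable (A : Set M) (S : Set M) : Prop :=
  ∃ F : Set (Set M), (∀ D ∈ F, A.Definable₁ L D) ∧ S = ⋂₀ F

variable [AddGroup M]

/-- The connected component `G_A^0` of `G = (M, +)` over `A`: the intersection of all `A`-definable
subgroups of finite index. -/
def connectedComponent (A : Set M) : AddSubgroup M :=
  sInf {H : AddSubgroup M | A.Definable₁ L (H : Set M) ∧ H.FiniteIndex}

/-- The subgroups of `G = (M, +)` which are type-definable over `A` and of bounded index, that is
of index less than `κ`. -/
def boundedTypeDefinableSubgroups (κ : Cardinal.{w}) (A : Set M) : Set (AddSubgroup M) :=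
  {H : AddSubgroup M | TypeDefinable L A (H : Set M) ∧ #(M ⧸ H) < κ}

/-- `H` is the type-connected component `G_A^{00}` of `G = (M, +)` over `A`: it is the smallest
subgroup of bounded index which is type-definable over `A`. -/
def IsTypeConnectedComponent (κ : Cardinal.{w}) (A : Set M) (H : AddSubgroup M) : Prop :=
  IsLeast (boundedTypeDefinableSubgroups L κ A) H

end Components

/-- The ring of integers as a first-order structure in the language of rings. -/
noncomputable instance instCompatibleRingInt : FirstOrder.Ring.CompatibleRing ℤ :=
  FirstOrder.Ring.compatibleRingOfRing ℤ

end ConnectedComponents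

namespace ConnectedComponents

open FirstOrder FirstOrder.Language Set

/-! ### Definable sets and polynomial maps over a ring. -/

section Definability

/-! Division with remainder transfers to `M`, so `nM` has finite index; conversely a subgroup of
finite index `d` contains `dM`. This computes `G^{*0}`. There are only countably many `∅`-definable
sets, and by saturation every definable set containing a bounded type-definable `H` covers `M` by
finitely many translates; hence `H` has index at most `𝔠`. The intersection of all such `H` is cut
out by countably many of those definable sets, so its index is at most `𝔠 ^ ℵ₀ = 𝔠 < κ`, and it is
`G_∅^{*00}`. For strictness, let `X` be the set defined in `M` by a formula for `X_{√2}(1/3)`. Then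
`K = {x | ∀ k, 2 ^ k * x ∈ X}` is a bounded type-definable subgroup (`sub_mem_sqrtTwoBohrSet`,
`exists_sub_mem_sqrtTwoBohrSet`). By irrationality of `√2` no nonzero `Nℤ` lies in `X_{√2}(1/3)`
(`exists_mul_notMem_sqrtTwoBohrSet`), so saturation yields an element divisible by every `n ≥ 1` and
outside `X`. -/

theorem _root_.Set.Definable₁.mono {L : Language} {M : Type*} [L.Structure M] {A B D : Set M}
    (hD : A.Definable₁ L D) (hAB : A ⊆ B) : B.Definable₁ L D :=
  Set.Definable.mono hD hAB

theorem _root_.Set.Definable₁.preimage {L : Language} {M α : Type*} [L.Structure M] {A D : Set M}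
    (hD : A.Definable₁ L D) {f : (α → M) → M} (hf : A.DefinableFun L f) :
    A.Definable L {v | f v ∈ D} :=
  Set.Definable.preimage_map (F := fun v (_ : Fin 1) => f v) (fun _ => hf) hD

theorem _root_.Set.Definable₁.of_exists {L : Language} {M : Type*} [L.Structure M] {A : Set M}
    {P : M → M → Prop}
    (h : A.Definable L {w : Fin 1 ⊕ Fin 1 → M | P (w (Sum.inl 0)) (w (Sum.inr 0))}) :
    A.Definable₁ L {x | ∃ y, P x y} := by
  refine cast (congrArg (A.Definable L) ?_) h.exists_of_finite
  ext v
  exact ⟨fun ⟨u, hu⟩ => ⟨u 0, hu⟩, fun ⟨y, hy⟩ => ⟨fun _ => y, hy⟩⟩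

variable {M α : Type*} [CommRing M] [FirstOrder.Ring.CompatibleRing M] {A : Set M}

theorem definableFun_lift (p : FreeCommRing α) :
    A.DefinableFun Language.ring fun v => FreeCommRing.lift v p := by
  refine .of_empty ?_
  have := (FirstOrder.Ring.termOfFreeCommRing p).definableFun_realize (M := M)
  simpa only [FirstOrder.Ring.realize_termOfFreeCommRing] using this

variable {f g : (α → M) → M}

theorem _root_.Set.DefinableFun.add (hf : A.DefinableFun Language.ring f)
    (hg : A.DefinableFun Language.ring g) : A.DefinableFun Language.ring fun v => f v + g v := by
  have h : A.DefinableMap Language.ring fun v => ![f v, g v] := by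
    intro i
    fin_cases i
    exacts [hf, hg]
  have := DefinableFun.comp h (definableFun_lift (FreeCommRing.of 0 + FreeCommRing.of 1))
  simpa only [map_add, FreeCommRing.lift_of] using! this

theorem _root_.Set.DefinableFun.mul (hf : A.DefinableFun Language.ring f)
    (hg : A.DefinableFun Language.ring g) : A.DefinableFun Language.ring fun v => f v * g v := by
  have h : A.DefinableMap Language.ring fun v => ![f v, g v] := by
    intro i
    fin_cases i
    exacts [hf, hg]
  have := DefinableFun.comp h (definableFun_lift (FreeCommRing.of 0 * FreeCommRing.of 1))
  simpa only [map_mul, FreeCommRing.lift_of] using! this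

theorem definableFun_intCast (n : ℤ) : A.DefinableFun Language.ring fun _ : α → M => (n : M) := by
  simpa using definableFun_lift (A := A) (n : FreeCommRing α)

theorem _root_.Set.DefinableFun.sub (hf : A.DefinableFun Language.ring f)
    (hg : A.DefinableFun Language.ring g) : A.DefinableFun Language.ring fun v => f v - g v := by
  have := hf.add ((definableFun_intCast (-1)).mul hg)
  simpa [sub_eq_add_neg] using this

end Definability

/-! ### Saturation for families of definable sets. -/

section Saturation

theorem IsSaturated.exists_forall_mem {L : Language} {M : Type*} [L.Structure M] {κ : Cardinal}
    (h : IsSaturated L M κ) {A : Set M} (hA : #A < κ) {ι : Type*} {D : ι → Set M}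
    (hD : ∀ i, A.Definable₁ L (D i)) (hfin : ∀ s : Finset ι, ∃ x, ∀ i ∈ s, x ∈ D i) :
    ∃ x, ∀ i, x ∈ D i := by
  classical
  obtain ⟨a, ha⟩ := h A hA {φ | ∃ i, ∀ x, φ.Realize (fun _ => x) ↔ x ∈ D i} (by
    intro q hq
    choose i hi using fun φ : q => hq φ.2
    obtain ⟨x, hx⟩ := hfin (q.attach.image i)
    exact ⟨x, fun φ hφ => (hi ⟨φ, hφ⟩ x).2
      (hx _ (Finset.mem_image_of_mem _ (Finset.mem_attach _ _)))⟩)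
  refine ⟨a, fun i => ?_⟩
  obtain ⟨φ, hφ⟩ := hD i
  have key : ∀ x, φ.Realize (fun _ => x) ↔ x ∈ D i := fun x =>
    (Set.ext_iff.1 hφ fun _ => x).symm
  exact (key a).1 (ha φ ⟨i, key⟩)

end Saturation

/-! ### Index bounds from countably many finite colourings. -/

section Index

theorem mk_le_continuum_of_injective {α ι : Type*} [Countable ι] {β : ι → Type*}
    (hβ : ∀ i, #(β i) ≤ 𝔠) {F : α → ∀ i, β i} (hF : Function.Injective F) : #α ≤ 𝔠 := by
  have he : ∀ i, ∃ e : β i → ℝ, Function.Injective e := fun i => by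
    obtain ⟨e⟩ := Cardinal.lift_mk_le'.1 (show Cardinal.lift #(β i) ≤ Cardinal.lift #ℝ by
      simpa [Cardinal.mk_real] using hβ i)
    exact ⟨e, e.injective⟩
  choose e he using he
  have hinj : Function.Injective fun (a : α) (i : ι) => e i (F a i) := fun a b hab =>
    hF (funext fun i => he i (congrFun hab i))
  have h := Cardinal.lift_mk_le_lift_mk_of_injective hinj
  have hι : #(ι → ℝ) ≤ 𝔠 := by
    rw [Cardinal.mk_arrow, Cardinal.mk_real, Cardinal.lift_continuum, Cardinal.lift_uzero]
    refine (Cardinal.power_le_power_left (Cardinal.continuum_ne_zero) Cardinal.mk_le_aleph0).trans ?_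
    rw [Cardinal.continuum_power_aleph0]
  rw [← Cardinal.lift_le_continuum]
  exact h.trans (Cardinal.lift_le_continuum.2 hι)

theorem mk_quotient_le_continuum {M : Type*} [AddGroup M] (H : AddSubgroup M) {ι : Type*}
    [Countable ι] (R : ι → M → M → Prop) (C : ι → Set M) (hC : ∀ i, (C i).Finite)
    (hcover : ∀ i x, ∃ c ∈ C i, R i x c)
    (hR : ∀ x y, (∀ i, ∃ c, R i x c ∧ R i y c) → x - y ∈ H) : #(M ⧸ H) ≤ 𝔠 := by
  choose c hcC hcR using hcover
  have hH : ∀ x y, (∀ i, c i x = c i y) → x - y ∈ H := fun x y h =>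
    hR x y fun i => ⟨c i x, hcR i x, h i ▸ hcR i y⟩
  refine mk_le_continuum_of_injective (β := fun i => C i)
    (fun i => ((hC i).lt_aleph0.le).trans Cardinal.aleph0_le_continuum)
    -- The negation turns the left-coset relation `-p + q ∈ H` into the difference form of `hR`.
    (F := fun q i => ⟨c i (-q.out), hcC i _⟩) fun p q hpq => ?_
  rw [← QuotientAddGroup.out_eq' p, ← QuotientAddGroup.out_eq' q, QuotientAddGroup.eq]
  simpa using hH (-p.out) (-q.out) fun i => Subtype.ext_iff.1 (congrFun hpq i)

end Index

/-! ### Existence of the type-connected component. -/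

section BoundedIndex

theorem countable_setOf_definable₁ (L : Language) (M : Type*) [L.Structure M]
    [Countable L.Symbols] :
    {D : Set M | (∅ : Set M).Definable₁ L D}.Countable := by
  have hinj : Function.Injective
      fun φ : L.Formula (Fin 1) => (⟨0, φ⟩ : Σ n, L.BoundedFormula (Fin 1) n) :=
    fun _ _ h => eq_of_heq (Sigma.mk.inj h).2
  have : Countable (L.Formula (Fin 1)) := hinj.countable
  refine (countable_range fun φ : L.Formula (Fin 1) => {x : M | φ.Realize fun _ => x}).mono ?_
  intro D hD
  obtain ⟨φ, hφ⟩ := empty_definable_iff.1 hD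
  exact ⟨φ, Set.ext fun x => (Set.ext_iff.1 hφ fun _ => x).symm⟩

/-- The `∅`-definable sets that contain `S`. -/
abbrev DefinableSuperset (L : Language) {M : Type*} [L.Structure M] (S : Set M) : Type _ :=
  {D : Set M // (∅ : Set M).Definable₁ L D ∧ S ⊆ D}

theorem TypeDefinable.mem_of_forall {L : Language} {M : Type*} [L.Structure M] {S : Set M}
    (hS : TypeDefinable L ∅ S) {x : M} (h : ∀ D : DefinableSuperset L S, x ∈ D.1) : x ∈ S := by
  obtain ⟨F, hF, rfl⟩ := hS
  exact fun D hD => h ⟨D, hF D hD, sInter_subset_of_mem hD⟩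

theorem DefinableSuperset.exists_subset {L : Language} {M : Type*} [L.Structure M] {S : Set M}
    (s : Finset (DefinableSuperset L S)) : ∃ E : DefinableSuperset L S, ∀ D ∈ s, E.1 ⊆ D.1 := by
  classical
  induction s using Finset.induction_on with
  | empty => exact ⟨⟨univ, definable_univ, subset_univ _⟩, by simp⟩
  | insert D s _ ih =>
    obtain ⟨E, hE⟩ := ih
    refine ⟨⟨E.1 ∩ D.1, E.2.1.inter D.2.1, subset_inter E.2.2 D.2.2⟩, fun D' hD' => ?_⟩
    rcases Finset.mem_insert.1 hD' with rfl | h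
    · exact inter_subset_right
    · exact inter_subset_left.trans (hE D' h)

variable {M : Type*} [CommRing M] [FirstOrder.Ring.CompatibleRing M] {κ : Cardinal}

/-- Compactness: otherwise two elements of `H` would have a difference outside `D`. Saturation
concerns 1-types, so `a` is realized before `b`, with `a` as parameter. -/
theorem IsSaturated.exists_superset_sub_mem (hsat : IsSaturated Language.ring M κ)
    (hκ : 1 < κ) {H : AddSubgroup M}
    (hH : TypeDefinable Language.ring ∅ (H : Set M))
    (D : DefinableSuperset Language.ring (H : Set M)) :
    ∃ E : DefinableSuperset Language.ring (H : Set M), ∀ x ∈ E.1, ∀ y ∈ E.1, x - y ∈ D.1 := by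
  by_contra! hcon
  obtain ⟨a, ha⟩ := hsat.exists_forall_mem (A := ∅) (by simpa using zero_le_one.trans_lt hκ)
    (D := fun E : DefinableSuperset Language.ring (H : Set M) =>
      {x | ∃ y, x ∈ E.1 ∧ y ∈ E.1 ∧ x - y ∉ D.1})
    (fun E => .of_exists ((E.2.1.preimage (.proj _)).inter ((E.2.1.preimage (.proj _)).inter
      (D.2.1.preimage ((DefinableFun.proj _).sub (.proj _))).compl)))
    (fun s => by
      obtain ⟨E, hE⟩ := DefinableSuperset.exists_subset s
      obtain ⟨x, hx, y, hy, hxy⟩ := hcon E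
      exact ⟨x, fun E' h => ⟨y, hE E' h hx, hE E' h hy, hxy⟩⟩)
  obtain ⟨b, hb⟩ := hsat.exists_forall_mem (A := {a}) (by simpa using hκ)
    (D := fun E : DefinableSuperset Language.ring (H : Set M) => {y | y ∈ E.1 ∧ a - y ∉ D.1})
    (fun E => ((Definable₁.mono E.2.1 (empty_subset _)).preimage (.proj _)).inter
      ((Definable₁.mono D.2.1 (empty_subset _)).preimage
        (((definableFun_const _ _ (mem_singleton a))).sub (.proj _))).compl)
    (fun s => by
      obtain ⟨E, hE⟩ := DefinableSuperset.exists_subset s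
      obtain ⟨y, _, hy, hay⟩ := ha E
      exact ⟨y, fun E' h => ⟨hE E' h hy, hay⟩⟩)
  have haH : a ∈ H := hH.mem_of_forall fun E => (ha E).choose_spec.1
  have hbH : b ∈ H := hH.mem_of_forall fun E => (hb E).1
  exact (hb D).2 (D.2.2 (H.sub_mem haH hbH))

/-- Otherwise saturation over fewer than `κ` coset representatives gives an element outside every
translate of `E`, yet it lies in some coset of `H ⊆ E`. -/
theorem IsSaturated.exists_finite_cover (hsat : IsSaturated Language.ring M κ)
    {H : AddSubgroup M} (hH : #(M ⧸ H) < κ)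
    (E : DefinableSuperset Language.ring (H : Set M)) :
    ∃ C : Set M, C.Finite ∧ ∀ x, ∃ c ∈ C, x - c ∈ E.1 := by
  by_contra! hcon
  obtain ⟨a, ha⟩ := hsat.exists_forall_mem (A := range (Quotient.out : M ⧸ H → M))
    (Cardinal.mk_range_le.trans_lt hH) (D := fun q : M ⧸ H => {x | x - q.out ∉ E.1})
    (fun q => ((Definable₁.mono E.2.1 (empty_subset _)).preimage
      ((DefinableFun.proj _).sub (definableFun_const _ _ (mem_range_self q)))).compl)
    (fun s => by
      classical
      obtain ⟨x, hx⟩ := hcon (Quotient.out '' (s : Set (M ⧸ H))) (s.finite_toSet.image _)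
      exact ⟨x, fun q hq => hx _ (mem_image_of_mem _ hq)⟩)
  refine ha (a : M ⧸ H) (E.2.2 ?_)
  have : -(a : M ⧸ H).out + a ∈ H := QuotientAddGroup.eq.1 (QuotientAddGroup.out_eq' _)
  simpa [sub_eq_neg_add] using this

theorem IsSaturated.mk_quotient_le_continuum (hsat : IsSaturated Language.ring M κ)
    (hκ : 1 < κ) {H : AddSubgroup M}
    (hH : H ∈ boundedTypeDefinableSubgroups Language.ring κ ∅) : #(M ⧸ H) ≤ 𝔠 := by
  choose C hC hcover using fun E => hsat.exists_finite_cover hH.2 E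
  have : Countable (DefinableSuperset Language.ring (H : Set M)) :=
    ((countable_setOf_definable₁ Language.ring M).mono fun _ hD => hD.1).to_subtype
  refine ConnectedComponents.mk_quotient_le_continuum H (fun E x c => x - c ∈ E.1) C hC hcover
    fun x y h => hH.1.mem_of_forall fun D => ?_
  obtain ⟨E, hE⟩ := hsat.exists_superset_sub_mem hκ hH.1 D
  obtain ⟨c, hx, hy⟩ := h E
  simpa using hE _ hx _ hy

theorem IsSaturated.exists_isTypeConnectedComponent (hsat : IsSaturated Language.ring M κ)
    (hκ : 𝔠 < κ) :
    ∃ H : AddSubgroup M, IsTypeConnectedComponent Language.ring κ ∅ H := by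
  let B := boundedTypeDefinableSubgroups (M := M) Language.ring κ ∅
  let 𝒟 : Set (Set M) := {D | (∅ : Set M).Definable₁ Language.ring D ∧ ∃ K ∈ B, (K : Set M) ⊆ D}
  have h𝒟 : ((sInf B : AddSubgroup M) : Set M) = ⋂₀ 𝒟 := by
    ext x
    rw [SetLike.mem_coe, AddSubgroup.mem_sInf]
    exact ⟨fun h D ⟨_, K, hK, hKD⟩ => hKD (h K hK), fun h K hK =>
      hK.1.mem_of_forall fun D => h _ ⟨D.2.1, K, hK, D.2.2⟩⟩
  have : Countable 𝒟 :=
    ((countable_setOf_definable₁ Language.ring M).mono fun _ hD => hD.1).to_subtype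
  -- One subgroup per definable set suffices: the intersection of the chosen `K D` is already `sInf
  -- B`.
  choose K hKB hKD using fun D : 𝒟 => D.2.2
  have hone : 1 < κ := (Cardinal.one_lt_aleph0.trans Cardinal.aleph0_lt_continuum).trans hκ
  refine ⟨sInf B, ⟨⟨𝒟, fun D hD => hD.1, h𝒟⟩, ?_⟩, fun K hK => sInf_le hK⟩
  refine (mk_le_continuum_of_injective (β := fun D => M ⧸ K D)
    (fun D => hsat.mk_quotient_le_continuum hone (hKB D))
    (F := fun q D => (q.out : M ⧸ K D)) fun p q hpq => ?_).trans_lt hκ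
  rw [← QuotientAddGroup.out_eq' p, ← QuotientAddGroup.out_eq' q, QuotientAddGroup.eq,
    ← SetLike.mem_coe, h𝒟]
  exact fun D hD => hKD ⟨D, hD⟩ (QuotientAddGroup.eq.1 (congrFun hpq ⟨D, hD⟩))

end BoundedIndex

/-! ### The Bohr set of `√2` in the integers. -/

section SqrtTwo

/-- The integers `n` for which `n √2` is at distance less than `1 / 3` from an integer. -/
def sqrtTwoBohrSet : Set ℤ := {n : ℤ | ∃ m : ℤ, |(m : ℝ) - (n : ℝ) * √2| < 1 / 3}

theorem eq_two_mul_of_abs_sub_lt {a b : ℤ} {x : ℝ} (ha : |(a : ℝ) - x| < 1 / 3)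
    (hb : |(b : ℝ) - 2 * x| < 1 / 3) : b = 2 * a := by
  rw [abs_lt] at ha hb
  have h1 : (b : ℝ) < 2 * a + 1 := by linarith
  have h2 : (2 * a : ℝ) < b + 1 := by linarith
  have h1' : b < 2 * a + 1 := by exact_mod_cast h1
  have h2' : 2 * a < b + 1 := by exact_mod_cast h2
  omega

/-- Membership of `2 * x` improves the bound `1/3` for `x` to `1/6`, since the integer near `2x√2`
must be twice the one near `x√2`. -/
theorem sub_mem_sqrtTwoBohrSet {x y : ℤ} (hx : x ∈ sqrtTwoBohrSet) (hx' : 2 * x ∈ sqrtTwoBohrSet)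
    (hy : y ∈ sqrtTwoBohrSet) (hy' : 2 * y ∈ sqrtTwoBohrSet) : x - y ∈ sqrtTwoBohrSet := by
  obtain ⟨a, ha⟩ := hx
  obtain ⟨b, hb⟩ := hx'
  obtain ⟨c, hc⟩ := hy
  obtain ⟨d, hd⟩ := hy'
  push_cast [mul_assoc] at hb hd
  obtain rfl := eq_two_mul_of_abs_sub_lt ha hb
  obtain rfl := eq_two_mul_of_abs_sub_lt hc hd
  push_cast at hb hd
  refine ⟨a - c, ?_⟩
  push_cast
  rw [abs_lt] at *
  constructor <;> linarith

theorem exists_sub_mem_sqrtTwoBohrSet (n : ℤ) :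
    ∃ c : Fin 5, n - (c : ℕ) ∈ sqrtTwoBohrSet ∧ 2 * (n - (c : ℕ)) ∈ sqrtTwoBohrSet := by
  suffices ∃ c : Fin 5, ∃ m : ℤ, |(m : ℝ) - (n - (c : ℕ)) * √2| < 1 / 6 by
    obtain ⟨c, m, h⟩ := this
    refine ⟨c, ⟨m, ?_⟩, ⟨2 * m, ?_⟩⟩ <;> push_cast <;> rw [abs_lt] at * <;>
      constructor <;> linarith
  have h1 : (1.4142 : ℝ) < √2 := Real.lt_sqrt_of_sq_lt (by norm_num)
  have h2 : √2 < (1.4143 : ℝ) := (Real.sqrt_lt' (by norm_num)).2 (by norm_num)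
  have hf := Int.floor_add_fract ((n : ℝ) * √2)
  have hf0 := Int.fract_nonneg ((n : ℝ) * √2)
  have hf1 := Int.fract_lt_one ((n : ℝ) * √2)
  set k := ⌊(n : ℝ) * √2⌋
  set t := Int.fract ((n : ℝ) * √2)
  -- Modulo 1 the multiples `c√2`, `c = 0, 3, 1, 4, 2`, are about 0, 0.243, 0.414, 0.657, 0.828.
  -- Consecutive gaps are below `1/3`, and the thresholds separate these points.
  by_cases c1 : t < 0.16
  · exact ⟨0, k, by rw [abs_lt]; constructor <;> norm_num <;> linarith⟩
  by_cases c2 : t < 0.4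
  · exact ⟨3, k - 4, by rw [abs_lt]; constructor <;> norm_num <;> linarith⟩
  by_cases c3 : t < 0.57
  · exact ⟨1, k - 1, by rw [abs_lt]; constructor <;> norm_num <;> linarith⟩
  by_cases c4 : t < 0.81
  · exact ⟨4, k - 5, by rw [abs_lt]; constructor <;> norm_num <;> linarith⟩
  by_cases c5 : t < 0.97
  · exact ⟨2, k - 2, by rw [abs_lt]; constructor <;> norm_num <;> linarith⟩
  · exact ⟨0, k + 1, by rw [abs_lt]; constructor <;> norm_num <;> linarith⟩

/-- If every `2 ^ k * N` were in the set, the approximating integers would double each time, and so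
would the error, which is nonzero by irrationality. -/
theorem exists_mul_notMem_sqrtTwoBohrSet {N : ℤ} (hN : N ≠ 0) :
    ∃ j : ℤ, N * j ∉ sqrtTwoBohrSet := by
  by_contra! hcon
  choose m hm using fun k : ℕ => hcon (2 ^ k)
  have hpow : ∀ k, m k = 2 ^ k * m 0 := by
    intro k
    induction k with
    | zero => simp
    | succ k ih =>
      rw [eq_two_mul_of_abs_sub_lt (hm k) (b := m (k + 1)), ih]
      · ring
      · convert hm (k + 1) using 3
        push_cast
        ring
  have hsmall : ∀ k : ℕ, 2 ^ k * |(m 0 : ℝ) - N * √2| < 1 / 3 := by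
    intro k
    have := hm k
    rw [hpow k] at this
    convert this using 1
    have h2 : (0 : ℝ) < 2 ^ k := by positivity
    calc 2 ^ k * |(m 0 : ℝ) - N * √2| = |2 ^ k * ((m 0 : ℝ) - N * √2)| := by
          rw [abs_mul, abs_of_pos h2]
      _ = _ := by
          push_cast
          congr 1
          ring
  have hpos : 0 < |(m 0 : ℝ) - N * √2| :=
    abs_pos.2 (sub_ne_zero.2 ((irrational_sqrt_two.intCast_mul hN).ne_int _).symm)
  obtain ⟨k, hk⟩ := pow_unbounded_of_one_lt (1 / |(m 0 : ℝ) - N * √2|) one_lt_two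
  rw [div_lt_iff₀ hpos] at hk
  linarith [hsmall k]

theorem definable_nonneg_int : (∅ : Set ℤ).Definable₁ Language.ring {x | 0 ≤ x} := by
  have hf : ∀ i : Fin 4, (∅ : Set ℤ).DefinableFun Language.ring
      fun w : Fin 1 ⊕ Fin 4 → ℤ => w (Sum.inr i) * w (Sum.inr i) := fun i =>
    .mul (.proj _) (.proj _)
  have h := (DefinableFun.ofPred_eq (.proj _ (i := Sum.inl 0))
    ((((hf 0).add (hf 1)).add (hf 2)).add (hf 3))).exists_of_finite
  refine cast (congrArg (Definable _ _) ?_) h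
  ext v
  refine ⟨fun ⟨u, hu⟩ => ?_, fun hv => ?_⟩
  · have hu : v 0 = u 0 * u 0 + u 1 * u 1 + u 2 * u 2 + u 3 * u 3 := hu
    show 0 ≤ v 0
    rw [hu]
    nlinarith [mul_self_nonneg (u 0), mul_self_nonneg (u 1), mul_self_nonneg (u 2),
      mul_self_nonneg (u 3)]
  -- Lagrange's four-square theorem defines the order.
  · obtain ⟨a, b, c, d, h⟩ := Nat.sum_four_squares (v 0).toNat
    refine ⟨![a, b, c, d], ?_⟩
    show v 0 = (a * a + b * b + c * c + d * d : ℤ)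
    have hv : 0 ≤ v 0 := hv
    zify at h
    rw [Int.toNat_of_nonneg hv] at h
    rw [← h]
    ring

variable {α : Type*} {f g : (α → ℤ) → ℤ}

theorem definable_lt_int (hf : (∅ : Set ℤ).DefinableFun Language.ring f)
    (hg : (∅ : Set ℤ).DefinableFun Language.ring g) :
    (∅ : Set ℤ).Definable Language.ring {v | f v < g v} := by
  convert definable_nonneg_int.preimage ((hg.sub hf).sub (definableFun_intCast 1)) using 1
  ext v
  simp only [mem_ofPred_eq, Int.cast_one]
  omega

theorem lt_mul_sqrt_two_iff (a b : ℤ) : (a : ℝ) < b * √2 ↔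
    (a < 0 ∧ -1 < b) ∨ (a < 0 ∧ 2 * (b * b) < a * a) ∨
      (-1 < a ∧ 0 < b ∧ a * a < 2 * (b * b)) := by
  have hs : √2 * √2 = 2 := Real.mul_self_sqrt (by norm_num)
  have hs0 : 0 < √2 := by positivity
  have hsq : (b * √2) * (b * √2) = ((2 * (b * b) : ℤ) : ℝ) := by
    push_cast
    linear_combination (b : ℝ) * b * hs
  have haa : (a : ℝ) * a = ((a * a : ℤ) : ℝ) := by push_cast; ring
  rcases lt_or_ge a 0 with ha | ha
  · have ha' : (a : ℝ) < 0 := by exact_mod_cast ha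
    rcases lt_or_ge b 0 with hb | hb
    · have hb' : (b : ℝ) < 0 := by exact_mod_cast hb
      have hbs : b * √2 < 0 := mul_neg_of_neg_of_pos hb' hs0
      have : (a : ℝ) < b * √2 ↔ 2 * (b * b) < a * a := by
        rw [← neg_lt_neg_iff, mul_self_lt_mul_self_iff (by linarith) (by linarith), neg_mul_neg,
          neg_mul_neg, hsq, haa, Int.cast_lt]
      rw [this]
      omega
    · have hb' : (0 : ℝ) ≤ b := by exact_mod_cast hb
      have : (a : ℝ) < b * √2 := ha'.trans_le (by positivity)
      simp only [this, true_iff]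
      omega
  · have ha' : (0 : ℝ) ≤ a := by exact_mod_cast ha
    rcases le_or_gt b 0 with hb | hb
    · have hb' : (b : ℝ) ≤ 0 := by exact_mod_cast hb
      have : ¬ (a : ℝ) < b * √2 :=
        not_lt.2 ((mul_nonpos_of_nonpos_of_nonneg hb' hs0.le).trans ha')
      simp only [this, false_iff]
      omega
    · have hb' : (0 : ℝ) < b := by exact_mod_cast hb
      rw [mul_self_lt_mul_self_iff ha' (by positivity), hsq, haa, Int.cast_lt]
      omega

theorem definable_lt_mul_sqrt_two (hf : (∅ : Set ℤ).DefinableFun Language.ring f)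
    (hg : (∅ : Set ℤ).DefinableFun Language.ring g) :
    (∅ : Set ℤ).Definable Language.ring {v | (f v : ℝ) < g v * √2} := by
  simp only [lt_mul_sqrt_two_iff]
  have h0 := definableFun_intCast (A := (∅ : Set ℤ)) (α := α) 0
  have h1 := definableFun_intCast (A := (∅ : Set ℤ)) (α := α) (-1)
  have h2 := definableFun_intCast (A := (∅ : Set ℤ)) (α := α) 2
  have hgg := h2.mul (hg.mul hg)
  exact ((definable_lt_int hf h0).inter (definable_lt_int h1 hg)).union
    (((definable_lt_int hf h0).inter (definable_lt_int hgg (hf.mul hf))).union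
      ((definable_lt_int h1 hf).inter
        ((definable_lt_int h0 hg).inter (definable_lt_int (hf.mul hf) hgg))))

theorem definable_sqrtTwoBohrSet : (∅ : Set ℤ).Definable₁ Language.ring sqrtTwoBohrSet := by
  have hset : sqrtTwoBohrSet = {n : ℤ | ∃ m : ℤ, ((3 * m - 1 : ℤ) : ℝ) < (3 * n : ℤ) * √2 ∧
      (((-3) * m - 1 : ℤ) : ℝ) < ((-3) * n : ℤ) * √2} := by
    ext n
    refine exists_congr fun m => ?_
    rw [abs_lt]
    push_cast
    constructor <;> rintro ⟨h1, h2⟩ <;> constructor <;> linarith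
  rw [hset]
  have hmul : ∀ (k : ℤ) (i : Fin 1 ⊕ Fin 1), (∅ : Set ℤ).DefinableFun Language.ring
      fun w : Fin 1 ⊕ Fin 1 → ℤ => k * w i := fun k i => (definableFun_intCast k).mul (.proj _)
  exact .of_exists ((definable_lt_mul_sqrt_two ((hmul 3 (Sum.inr 0)).sub (definableFun_intCast 1))
    (hmul 3 (Sum.inl 0))).inter (definable_lt_mul_sqrt_two
      ((hmul (-3) (Sum.inr 0)).sub (definableFun_intCast 1)) (hmul (-3) (Sum.inl 0))))

end SqrtTwo

/-! ### Transfer from the integers to `M`. -/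

section Transfer

theorem realize_of_forall_realize {L : Language} {N M : Type*} [L.Structure N] [L.Structure M]
    (f : N ↪ₑ[L] M) {α : Type*} [Finite α] {φ : L.Formula α} (h : ∀ v : α → N, φ.Realize v)
    (v : α → M) : φ.Realize v := by
  let ψ : L.Formula Empty := (φ.relabel (Sum.inr : α → Empty ⊕ α)).iAlls α
  have hN : ψ.Realize (Empty.elim : Empty → N) := by
    simpa [ψ, Function.comp_def] using h
  have hM := (f.map_formula ψ Empty.elim).2 hN
  simp only [ψ, Formula.realize_iAlls, Formula.realize_relabel] at hM
  exact hM v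

/-- The formula expressing that the value of the polynomial `p` satisfies `φ`. -/
noncomputable def formulaAt {α : Type*} (φ : Language.ring.Formula (Fin 1)) (p : FreeCommRing α) :
    Language.ring.Formula α :=
  φ.subst fun _ => FirstOrder.Ring.termOfFreeCommRing p

theorem realize_formulaAt {R α : Type*} [CommRing R] [FirstOrder.Ring.CompatibleRing R]
    (φ : Language.ring.Formula (Fin 1)) (p : FreeCommRing α) (v : α → R) :
    (formulaAt φ p).Realize v ↔ φ.Realize fun _ => FreeCommRing.lift v p := by
  rw [formulaAt, Formula.Realize, BoundedFormula.realize_subst]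
  simp [Formula.Realize]

variable {M : Type*} [CommRing M] [FirstOrder.Ring.CompatibleRing M] (f : ℤ ↪ₑ[Language.ring] M)

include f in
theorem exists_eq_mul_add {n : ℕ} (hn : 1 ≤ n) (x : M) :
    ∃ (i : Fin n) (y : M), x = n * y + (i : ℕ) := by
  let θ : Fin n → Language.ring.Formula (Fin 1 ⊕ Fin 1) := fun i =>
    (FirstOrder.Ring.termOfFreeCommRing (FreeCommRing.of (Sum.inl 0))).equal
      (FirstOrder.Ring.termOfFreeCommRing
        ((n : FreeCommRing _) * FreeCommRing.of (Sum.inr 0) + ((i : ℕ) : FreeCommRing _)))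
  have h : ∀ v : Fin 1 → ℤ, (Formula.iSup fun i => (θ i).iExs (Fin 1)).Realize v := by
    intro v
    simp only [Formula.realize_iSup, Formula.realize_iExs, θ, Formula.realize_equal,
      FirstOrder.Ring.realize_termOfFreeCommRing, map_add, map_mul, map_natCast,
      FreeCommRing.lift_of, Sum.elim_inl, Sum.elim_inr]
    have hn' : (0 : ℤ) < n := by exact_mod_cast hn
    have h0 := Int.emod_nonneg (v 0) hn'.ne'
    have h1 := Int.emod_lt_of_pos (v 0) hn'
    refine ⟨⟨(v 0 % n).toNat, by omega⟩, fun _ => v 0 / n, ?_⟩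
    simp only [Int.toNat_of_nonneg h0]
    exact (Int.mul_ediv_add_emod _ _).symm
  have hM := realize_of_forall_realize f h fun _ => x
  simp only [Formula.realize_iSup, Formula.realize_iExs, θ, Formula.realize_equal,
    FirstOrder.Ring.realize_termOfFreeCommRing, map_add, map_mul, map_natCast,
    FreeCommRing.lift_of, Sum.elim_inl, Sum.elim_inr] at hM
  obtain ⟨i, y, hy⟩ := hM
  exact ⟨i, y 0, hy⟩

theorem elementaryEmbedding_map_intCast (n : ℤ) : f n = n := by
  have hadd : ∀ a b, f (a + b) = f a + f b := fun a b => by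
    have h := f.map_fun FirstOrder.Ring.addFunc ![a, b]
    simpa using! h
  have hone : f 1 = 1 := by
    have h := f.map_fun FirstOrder.Ring.oneFunc ![]
    simpa using! h
  have h : f (n • 1) = n • f 1 := map_zsmul (AddMonoidHom.mk' f hadd) n 1
  rwa [hone, zsmul_one, zsmul_one, Int.cast_id] at h

end Transfer

/-! ### Computing `G^{*0}` and separating it from `G_∅^{*00}`. -/

section Component

variable {M : Type*} [CommRing M] [FirstOrder.Ring.CompatibleRing M] (f : ℤ ↪ₑ[Language.ring] M)

theorem definable_range_nsmul (A : Set M) (n : ℕ) :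
    A.Definable₁ Language.ring (range fun x : M => n • x) := by
  have h : A.Definable₁ Language.ring {x | ∃ y : M, (n : ℤ) * y = x} :=
    .of_exists (DefinableFun.ofPred_eq ((definableFun_intCast (n : ℤ)).mul (.proj _)) (.proj _))
  simpa [range, nsmul_eq_mul] using h

include f in
theorem finiteIndex_range_nsmul {n : ℕ} (hn : 1 ≤ n) :
    (nsmulAddMonoidHom (α := M) n).range.FiniteIndex := by
  have : Finite (M ⧸ (nsmulAddMonoidHom (α := M) n).range) := by
    refine Finite.of_surjective (fun i : Fin n => (((i : ℕ) : M) : M ⧸ _)) fun q => ?_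
    obtain ⟨x, rfl⟩ := QuotientAddGroup.mk_surjective q
    obtain ⟨i, y, rfl⟩ := exists_eq_mul_add f hn x
    exact ⟨i, QuotientAddGroup.eq.2 ⟨y, by simp⟩⟩
  exact AddSubgroup.finiteIndex_of_finite_quotient

include f in
theorem coe_connectedComponent_eq (A : Set M) :
    (connectedComponent Language.ring A : Set M) =
      ⋂ n : ℕ, ⋂ _ : 1 ≤ n, range fun x : M => n • x := by
  ext x
  simp only [connectedComponent, SetLike.mem_coe, AddSubgroup.mem_sInf, mem_iInter]
  refine ⟨fun h n hn => ?_, fun h H hH => ?_⟩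
  · exact h (nsmulAddMonoidHom n).range ⟨by exact definable_range_nsmul A n,
      finiteIndex_range_nsmul f hn⟩
  · have := hH.2
    obtain ⟨y, rfl⟩ := h H.index (Nat.one_le_iff_ne_zero.2 this.index_ne_zero)
    exact H.nsmul_index_mem y

include f in
/-- A nonstandard Bohr neighbourhood gives a bounded type-definable subgroup that does not contain
all elements divisible by every positive integer. -/
theorem exists_boundedTypeDefinableSubgroup_not_le {κ : Cardinal} (hκ : 𝔠 < κ)
    (hsat : IsSaturated Language.ring M κ) :
    ∃ K ∈ boundedTypeDefinableSubgroups Language.ring κ (∅ : Set M),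
      ¬ connectedComponent Language.ring (∅ : Set M) ≤ K := by
  obtain ⟨φ, hφ⟩ := empty_definable_iff.1 definable_sqrtTwoBohrSet
  have hφ : ∀ n : ℤ, φ.Realize (fun _ => n) ↔ n ∈ sqrtTwoBohrSet := fun n =>
    (Set.ext_iff.1 hφ fun _ => n).symm
  let X : Set M := {x | φ.Realize fun _ => x}
  have hX : ∀ n : ℤ, (n : M) ∈ X ↔ n ∈ sqrtTwoBohrSet := fun n => by
    rw [← hφ, ← f.map_formula φ, ← elementaryEmbedding_map_intCast f]
    rfl
  have hXdef : (∅ : Set M).Definable₁ Language.ring X := by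
    refine empty_definable_iff.2 ⟨φ, ?_⟩
    ext v
    show φ.Realize (fun _ => v 0) ↔ φ.Realize v
    rw [show (fun _ : Fin 1 => v 0) = v from funext fun i => by rw [Subsingleton.elim i 0] ]
  have hsub : ∀ x y : M, x ∈ X → 2 * x ∈ X → y ∈ X → 2 * y ∈ X → x - y ∈ X := by
    intro x y
    let x₀ : FreeCommRing (Fin 2) := .of 0
    let x₁ : FreeCommRing (Fin 2) := .of 1
    have key := realize_of_forall_realize f (φ := (formulaAt φ x₀).imp
      ((formulaAt φ (x₀ + x₀)).imp ((formulaAt φ x₁).imp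
        ((formulaAt φ (x₁ + x₁)).imp (formulaAt φ (x₀ - x₁)))))) (by
      intro v
      simp only [Formula.realize_imp, realize_formulaAt, hφ]
      simpa [x₀, x₁, two_mul] using! sub_mem_sqrtTwoBohrSet) ![x, y]
    simp only [Formula.realize_imp, realize_formulaAt] at key
    simpa [x₀, x₁, two_mul] using! key
  have hcover : ∀ x : M, ∃ c : Fin 5, x - (c : ℕ) ∈ X ∧ 2 * (x - (c : ℕ)) ∈ X := by
    intro x
    let x₀ : FreeCommRing (Fin 1) := .of 0
    have key := realize_of_forall_realize f (φ := Formula.iSup fun c : Fin 5 =>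
        formulaAt φ (x₀ - ((c : ℕ) : FreeCommRing _)) ⊓
          formulaAt φ (x₀ - ((c : ℕ) : FreeCommRing _) + (x₀ - ((c : ℕ) : FreeCommRing _)))) (by
      intro v
      simp only [Formula.realize_iSup, Formula.realize_inf, realize_formulaAt, hφ]
      simpa [x₀, two_mul] using! exists_sub_mem_sqrtTwoBohrSet (v 0)) ![x]
    simp only [Formula.realize_iSup, Formula.realize_inf, realize_formulaAt] at key
    simpa [x₀, two_mul] using! key
  have hzero : (0 : M) ∈ X := by
    have : (0 : ℤ) ∈ sqrtTwoBohrSet := ⟨0, by simp⟩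
    simpa using (hX 0).2 this
  have hKsub : ∀ x y : M, (∀ k : ℕ, 2 ^ k * x ∈ X) → (∀ k : ℕ, 2 ^ k * y ∈ X) →
      ∀ k : ℕ, 2 ^ k * (x - y) ∈ X := fun x y hx hy k => by
    rw [mul_sub]
    refine hsub _ _ (hx k) ?_ (hy k) ?_
    · simpa [pow_succ', mul_assoc] using hx (k + 1)
    · simpa [pow_succ', mul_assoc] using hy (k + 1)
  let K : AddSubgroup M := AddSubgroup.ofSub {x | ∀ k : ℕ, 2 ^ k * x ∈ X} ⟨0, by simpa using hzero⟩
    (fun x hx y hy => by simpa [sub_eq_add_neg] using! hKsub x y hx hy)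
  have hK : ∀ x, x ∈ K ↔ ∀ k : ℕ, 2 ^ k * x ∈ X := fun x => Iff.rfl
  refine ⟨K, ⟨⟨range fun k : ℕ => {x | 2 ^ k * x ∈ X}, ?_, ?_⟩, ?_⟩, fun hle => ?_⟩
  · rintro _ ⟨k, rfl⟩
    have := hXdef.preimage ((definableFun_intCast (2 ^ k)).mul
      (.proj Language.ring (α := Fin 1) (i := 0)))
    simpa using! this
  · ext x
    simp [hK]
  -- Colour `x` at level `k` by a `c` among five with `2 ^ k * x - c` and its double in `X`; equal
  -- colours put `2 ^ k * (x - y)` in `X` by `hsub`.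
  · refine (mk_quotient_le_continuum K (ι := ℕ)
      (fun k x c => 2 ^ k * x - c ∈ X ∧ 2 * (2 ^ k * x - c) ∈ X)
      (fun _ => range fun c : Fin 5 => ((c : ℕ) : M)) (fun _ => finite_range _)
      (fun k x => ?_) fun x y h => ?_).trans_lt hκ
    · obtain ⟨c, hc⟩ := hcover (2 ^ k * x)
      exact ⟨_, mem_range_self c, hc⟩
    · refine (hK _).2 fun k => ?_
      obtain ⟨c, hx, hy⟩ := h k
      have := hsub _ _ hx.1 hx.2 hy.1 hy.2
      rwa [sub_sub_sub_cancel_right, ← mul_sub] at this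
  · obtain ⟨x, hx⟩ := hsat.exists_forall_mem (A := ∅)
      (by simpa using (Cardinal.continuum_pos).trans hκ)
      (D := fun n : ℕ => {x : M | x ∈ range (fun x : M => (n + 1) • x) ∧ x ∉ X})
      (fun n => (definable_range_nsmul ∅ (n + 1)).inter (Definable.compl hXdef))
      (fun s => by
        -- A multiple of the product of the finitely many moduli meets all the divisibility
        -- conditions at once.
        obtain ⟨j, hj⟩ := exists_mul_notMem_sqrtTwoBohrSet
          (N := ((∏ n ∈ s, (n + 1) : ℕ) : ℤ))
          (by exact_mod_cast Finset.prod_ne_zero_iff.2 fun n _ => Nat.succ_ne_zero n)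
        refine ⟨((((∏ n ∈ s, (n + 1) : ℕ) : ℤ) * j : ℤ) : M), fun n hn => ⟨?_, by rwa [hX]⟩⟩
        obtain ⟨m, hm⟩ := Finset.dvd_prod_of_mem (fun n : ℕ => n + 1) hn
        refine ⟨(m * j : ℤ), ?_⟩
        rw [hm]
        push_cast [nsmul_eq_mul]
        ring)
    have hxG : x ∈ (connectedComponent Language.ring (∅ : Set M) : Set M) := by
      rw [coe_connectedComponent_eq f]
      refine mem_iInter₂.2 fun n hn => ?_
      obtain ⟨n, rfl⟩ := Nat.exists_eq_add_of_le' hn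
      exact (hx n).1
    exact (hx 0).2 (by simpa using (hK x).1 (hle hxG) 0)

include f in
theorem IsTypeConnectedComponent.lt_connectedComponent {κ : Cardinal} (hκ : 𝔠 < κ)
    (hsat : IsSaturated Language.ring M κ) {H : AddSubgroup M}
    (hH : IsTypeConnectedComponent Language.ring κ ∅ H) :
    H < connectedComponent Language.ring (∅ : Set M) := by
  obtain ⟨K, hK, hKG⟩ := exists_boundedTypeDefinableSubgroup_not_le f hκ hsat
  refine lt_of_le_not_ge (le_sInf fun N hN => hH.2 ⟨⟨{(N : Set M)}, ?_, by simp⟩, ?_⟩)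
    fun hle => hKG (hle.trans (hH.2 hK))
  · rintro _ rfl
    exact hN.1
  · have := hN.2
    exact (Cardinal.lt_aleph0_of_finite _).trans (Cardinal.aleph0_lt_continuum.trans hκ)

end Component

end ConnectedComponents

theorem corollary4p5 :
    (∀ (M : Type*) [CommRing M] [FirstOrder.Ring.CompatibleRing M]
        (_ : ℤ ↪ₑ[FirstOrder.Language.ring] M)
        (κ : Cardinal) (_ : 𝔠 < κ)
        (_ : ConnectedComponents.IsSaturated FirstOrder.Language.ring M κ)
        (_ : ConnectedComponents.IsStronglyHomogeneous FirstOrder.Language.ring M κ),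
      -- `G^{*0}` exists and is the intersection of the subgroups `n M`, `n ≥ 1`
      (∀ A : Set M, #A < κ →
        (ConnectedComponents.connectedComponent FirstOrder.Language.ring A : Set M) =
          ⋂ n : ℕ, ⋂ _ : 1 ≤ n, Set.range (fun x : M => n • x)) ∧
      -- `G_∅^{*00}` exists and is strictly smaller than `G^{*0}`
      (∃ H : AddSubgroup M,
        ConnectedComponents.IsTypeConnectedComponent FirstOrder.Language.ring κ ∅ H ∧
        H < ConnectedComponents.connectedComponent FirstOrder.Language.ring (∅ : Set M))) ∧
    -- the predicate `X_{√2}(1/3)` is definable in `(ℤ, +, ·)`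
    (∅ : Set ℤ).Definable₁ FirstOrder.Language.ring
      {n : ℤ | ∃ m : ℤ, |(m : ℝ) - (n : ℝ) * √2| < 1 / 3} := by
  refine ⟨fun M _ _ f κ hκ hsat _ => ⟨fun A _ => ConnectedComponents.coe_connectedComponent_eq f A,
    ?_⟩, ConnectedComponents.definable_sqrtTwoBohrSet⟩
  obtain ⟨H, hH⟩ := hsat.exists_isTypeConnectedComponent hκ
  exact ⟨H, hH, hH.lt_connectedComponent f hκ hsat⟩
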